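/- All graphs are finite and simple. For a graph $\Gamma$ and a real number $\lambda$ put $GRM_\lambda(\Gamma)=\sum_{ab\in E(\Gamma)}(\deg_\Gamma(a)+\lambda)(\deg_\Gamma(b)+\lambda)$. A graph is unicyclic if it is connected and contains exactly one cycle; let $\mathcal U_{n,\Delta}$ be the set of all unicyclic graphs with $n$ vertices and maximum degree $\Delta$. Let $\mathcal U^{(2)}_{n,\Delta}\subseteq\mathcal U_{n,\Delta}$ consist of the graphs obtained from the disjoint union of a cycle $C$ and a star $K_{1,\Delta-1}$ by joining the center of the star to a vertex of $C$ by a path of length at least $2$ (whose inner vertices are new). Let $U^{(3)}_{n,\Delta}\in\mathcal U_{n,\Delta}$ be the graph obtained by identifying a vertex of the cycle $C_{n-(\Delta-2)}$ with the center of a star $K_{1,\Delta-2}$. Theorem. Let $\lambda\ge-\frac12$ and $\Delta\ge3$, and let $U\in\mathcal U_{n,\Delta}$. (i) If $2\lambda+6<\Delta<n-3$, then $$GRM_\lambda(U)\ge(\Delta+\lambda)(\Delta+\Delta\lambda+1)+(n-\Delta)(2+\lambda)^2+3(2+\lambda),$$ with equality if and only if $U\in\mathcal U^{(2)}_{n,\Delta}$.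 (ii) If $3\le\Delta<2\lambda+6$ or $n-3\le\Delta\le n-1$, then $$GRM_\lambda(U)\ge(\Delta+\lambda)(\Delta+\Delta\lambda+2)+(n-\Delta)(2+\lambda)^2,$$ with equality if and only if $U$ is isomorphic to $U^{(3)}_{n,\Delta}$. (iii) If $\Delta=2\lambda+6$, then $$GRM_\lambda(U)\ge6(2+\lambda)^3+(n-2\lambda-6)(2+\lambda)^2,$$ with equality if and only if $U\in\mathcal U^{(2)}_{n,\Delta}$ or $U$ is isomorphic to $U^{(3)}_{n,\Delta}$. The bounds are sharp: for $\Delta\ge3$ the graph $U^{(3)}_{n,\Delta}$ exists whenever $\Delta\le n-1$, and $\mathcal U^{(2)}_{n,\Delta}$ is non-empty whenever $\Delta<n-3$. -/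

import Mathlib

open Classical in
/-- The general reduced second Zagreb index of a finite simple graph:
the sum over the edges `ab` of `(deg a + lam) * (deg b + lam)`. -/
noncomputable def GRM {V : Type*} [Fintype V] (lam : ℝ) (G : SimpleGraph V) : ℝ :=
  ∑ e ∈ G.edgeFinset,
    Sym2.lift ⟨fun a b => ((G.degree a : ℝ) + lam) * ((G.degree b : ℝ) + lam),
      fun _ _ => mul_comm _ _⟩ e

/-- A unicyclic graph: connected, with exactly one cycle.  A cycle is a subgraph traced by a
cyclic walk, so that neither the starting point nor the orientation of the walk matters. -/
def IsUnicyclic {V : Type*} (G : SimpleGraph V) : Prop :=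
  G.Connected ∧
    ∃! C : G.Subgraph, ∃ (v : V) (p : G.Walk v v), p.IsCycle ∧ p.toSubgraph = C

open Classical in
/-- The set of all unicyclic graphs with vertex set `V` and maximum degree `Δ`. -/
def unicyclicGraphs (V : Type*) [Fintype V] (Δ : ℕ) : Set (SimpleGraph V) :=
  {G | IsUnicyclic G ∧ G.maxDegree = Δ}

/-- The graphs in `unicyclicGraphs V Δ` that are made of a cycle `c`, a star with centre `a` and
set of leaves `L`, where `L` has `Δ - 1` elements, the star being disjoint from the cycle, and a
path `q` of length at least `2` from `a` to a vertex `b` of the cycle, all of whose inner vertices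
are new.  The last two conditions say that there are no further vertices or edges. -/
def starPathCycleGraphs (V : Type*) [Fintype V] (Δ : ℕ) : Set (SimpleGraph V) :=
  {G | G ∈ unicyclicGraphs V Δ ∧
    ∃ (a b : V) (c : G.Walk b b) (q : G.Walk a b) (L : Finset V),
      c.IsCycle ∧ q.IsPath ∧ 2 ≤ q.length ∧ L.card + 1 = Δ ∧
      a ∉ c.support ∧ (∀ x ∈ L, x ∉ c.support) ∧
      (∀ x ∈ q.support, x ∈ c.support → x = b) ∧ (∀ x ∈ q.support, x ∉ L) ∧
      (∀ x, x ∈ c.support ∨ x ∈ q.support ∨ x ∈ L) ∧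
      (∀ x y, G.Adj x y ↔
        s(x, y) ∈ c.edges ∨ s(x, y) ∈ q.edges ∨ (x = a ∧ y ∈ L) ∨ (y = a ∧ x ∈ L))}

/-- The graphs in `unicyclicGraphs V Δ` that are made of a cycle `c` through a vertex `a` and a
star with centre `a` and set of leaves `L`, where `L` has `Δ - 2` elements, none of them on the
cycle (which therefore has `|V| - (Δ - 2)` vertices).  The last two conditions say that there are
no further vertices or edges; so these graphs form one isomorphism class. -/
def starOnCycleGraphs (V : Type*) [Fintype V] (Δ : ℕ) : Set (SimpleGraph V) :=
  {G | G ∈ unicyclicGraphs V Δ ∧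
    ∃ (a : V) (c : G.Walk a a) (L : Finset V),
      c.IsCycle ∧ L.card + 2 = Δ ∧
      (∀ x ∈ L, x ∉ c.support) ∧
      (∀ x, x ∈ c.support ∨ x ∈ L) ∧
      (∀ x y, G.Adj x y ↔ s(x, y) ∈ c.edges ∨ (x = a ∧ y ∈ L) ∨ (y = a ∧ x ∈ L))}

/-!
The index is expressed through the degree excesses `y v = deg v - 2` (truncated at `0`).  A unicyclic
graph has as many edges as vertices, so the numbers `deg v - 2` add up to `0`; hence the number of
leaves is `∑ y v`, and expanding the products `(deg a + lam) * (deg b + lam)` gives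
`GRM lam G = n * (2 + lam) ^ 2 + ∑ v, ((2 + lam) * y v * (y v + 1) - l v * y v) + ∑ ab, y a * y b`,
where `l v` is the number of leaves adjacent to `v` (`GRM_eq_sum_vertexShare`).  Every vertex has a
neighbour that is not a leaf, so `l v ≤ y v + 1` where `y v ≠ 0`, and as `1 < 2 + lam` all the
summands are nonnegative, positive where `y v ≠ 0`.

Now let `a` be a vertex of maximum degree `Δ`.  If at most `Δ - 2` of its neighbours are leaves, then
the summand of `a` alone gives the value of a cycle with a star on it, and equality forces all other
excesses to vanish (`starOnCycle_le_GRM_of_card_leafNeighbors_le`).  Otherwise `Δ - 1` of its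
neighbours are leaves, `a` is outside the cycle, and the vertex `b` where the path from `a` reaches
the cycle has three neighbours that are not leaves; so the summand of `b` is at least
`2 * (2 + lam)`, and the summands of `a` and `b` give the value of a star joined to a cycle by a
path, with equality only if `y b = 1`, all other excesses vanish, and `a` and `b` are not adjacent
(`starPathCycle_le_GRM_of_le_card_leafNeighbors`).  The two values differ by `Δ - (2 * lam + 6)`,
and when `n ≤ Δ + 3` the vertices `a` and `b` are adjacent, which makes the second case exceed the
first value.

In each equality case the degrees determine the graph: the cycle, the path and the leaves account
for all the degrees of their vertices, so by connectedness there is nothing else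
(`SimpleGraph.Connected.forall_mem_and_adj_iff`).  The same recognition lemmas show that explicitly
constructed graphs belong to the two families.
-/

/-! ### Counting the edges of unicyclic graphs -/

section EdgeCount

variable {V : Type*} {G : SimpleGraph V}

/-- If all cycles pass through one edge `s(u, v)`, then there is only one: two cycles give two paths
from `v` to `u` that avoid `s(u, v)`, and if these differ, then their union contains a cycle that
avoids `s(u, v)`. -/
theorem isUnicyclic_of_forall_mem_edges (hG : G.Connected) {u v : V}
    (hall : ∀ (w : V) (p : G.Walk w w), p.IsCycle → s(u, v) ∈ p.edges)
    (hex : ∃ (w : V) (p : G.Walk w w), p.IsCycle) : IsUnicyclic G := by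
  classical
  have key : ∀ (w : V) (p : G.Walk w w), p.IsCycle → ∃ (h : G.Adj u v) (t : G.Walk v u),
      t.IsPath ∧ s(u, v) ∉ t.edges ∧ p.toSubgraph = (SimpleGraph.Walk.cons h t).toSubgraph := by
    intro w p hp
    have hu : u ∈ p.support := p.fst_mem_support_of_mem_edges (hall w p hp)
    have hp' : (p.rotate u hu).IsCycle := by simpa using hp
    have hsub : (p.rotate u hu).toSubgraph = p.toSubgraph := by simp
    have hadj : (p.rotate u hu).toSubgraph.Adj u v := by
      rw [hsub, SimpleGraph.Walk.adj_toSubgraph_iff_mem_edges]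
      exact hall w p hp
    obtain ⟨r, hr, hrv, hrs⟩ : ∃ r : G.Walk u u, r.IsCycle ∧ r.snd = v ∧
        r.toSubgraph = p.toSubgraph := by
      have : v ∈ (p.rotate u hu).toSubgraph.neighborSet u := hadj
      rw [hp'.neighborSet_toSubgraph_endpoint] at this
      rcases this with h | h
      · exact ⟨_, hp', h.symm, hsub⟩
      · refine ⟨_, hp'.reverse, ?_, ?_⟩
        · rw [SimpleGraph.Walk.snd_reverse]
          exact h.symm
        · rw [SimpleGraph.Walk.toSubgraph_reverse, hsub]
    subst hrv
    have hc := SimpleGraph.Walk.cons_tail_eq r hr.not_nil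
    refine ⟨r.adj_snd hr.not_nil, r.tail, hr.isPath_tail, ?_, ?_⟩
    · have := hr
      rw [← hc, SimpleGraph.Walk.cons_isCycle_iff] at this
      exact this.2
    · rw [hc, hrs]
  refine ⟨hG, ?_⟩
  obtain ⟨w, p, hp⟩ := hex
  refine ⟨p.toSubgraph, ⟨w, p, hp, rfl⟩, ?_⟩
  rintro _ ⟨w', p', hp', rfl⟩
  obtain ⟨h, t, ht, hte, hts⟩ := key w p hp
  obtain ⟨h', t', ht', hte', hts'⟩ := key w' p' hp'
  have : t = t' := by
    by_contra hne
    obtain ⟨x, y, q, q', hq, hq', hcyc⟩ := ht.exists_isCycle_of_ne ht' hne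
    have := hall _ _ hcyc
    rw [SimpleGraph.Walk.edges_append, List.mem_append, SimpleGraph.Walk.edges_reverse,
      List.mem_reverse] at this
    rcases this with h | h
    · exact hte (hq.edges_subset h)
    · exact hte' (hq'.edges_subset h)
  subst this
  rw [hts, hts']

variable [Finite V]

theorem card_edgeSet_deleteEdges_singleton {e : Sym2 V} (he : e ∈ G.edgeSet) :
    Nat.card (G.deleteEdges {e}).edgeSet + 1 = Nat.card G.edgeSet := by
  rw [SimpleGraph.edgeSet_deleteEdges, Nat.card_coe_set_eq, Nat.card_coe_set_eq,
    Set.ncard_sdiff_singleton_add_one he]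

theorem IsUnicyclic.card_edgeSet (h : IsUnicyclic G) : Nat.card G.edgeSet = Nat.card V := by
  classical
  obtain ⟨hG, C, ⟨v, p, hp, rfl⟩, huniq⟩ := h
  obtain ⟨e, he⟩ : ∃ e, e ∈ p.edges :=
    ⟨_, SimpleGraph.Walk.mk_penultimate_end_mem_edges hp.not_nil⟩
  induction e with | h x y =>
  have hb : ¬ G.IsBridge s(x, y) := fun hb => hb.notMem_edges_of_isCycle hp he
  have hc := hG.connected_delete_edge_of_not_isBridge hb
  have hT : (G.deleteEdges {s(x, y)}).IsTree := by
    refine ⟨hc, fun w q hq => ?_⟩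
    have hle : G.deleteEdges {s(x, y)} ≤ G := SimpleGraph.deleteEdges_le _
    have h1 := huniq (q.mapLe hle).toSubgraph ⟨w, _, hq.mapLe hle, rfl⟩
    have h2 : s(x, y) ∈ (q.mapLe hle).edges := by
      rw [← SimpleGraph.Walk.mem_edges_toSubgraph, h1, SimpleGraph.Walk.mem_edges_toSubgraph]
      exact he
    rw [SimpleGraph.Walk.edges_mapLe_eq_edges] at h2
    have := q.edges_subset_edgeSet h2
    simp at this
  rw [← (SimpleGraph.isTree_iff_connected_and_card.1 hT).2]
  exact (card_edgeSet_deleteEdges_singleton (p.edges_subset_edgeSet he)).symm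

/-- A connected graph with as many edges as vertices is not a tree, and becomes one when an edge of
a cycle is deleted; so every cycle passes through that edge. -/
theorem isUnicyclic_of_connected_of_card_edgeSet (hG : G.Connected)
    (hcard : Nat.card G.edgeSet = Nat.card V) : IsUnicyclic G := by
  classical
  have hnt : ¬ G.IsAcyclic := fun h => by
    have := (SimpleGraph.isTree_iff_connected_and_card.1 ⟨hG, h⟩).2
    omega
  simp only [SimpleGraph.IsAcyclic, not_forall, not_not] at hnt
  obtain ⟨v, p, hp⟩ := hnt
  obtain ⟨e, he⟩ : ∃ e, e ∈ p.edges :=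
    ⟨_, SimpleGraph.Walk.mk_penultimate_end_mem_edges hp.not_nil⟩
  induction e with | h x y =>
  have hb : ¬ G.IsBridge s(x, y) := fun hb => hb.notMem_edges_of_isCycle hp he
  have hc := hG.connected_delete_edge_of_not_isBridge hb
  have hT : (G.deleteEdges {s(x, y)}).IsTree := by
    refine SimpleGraph.isTree_iff_connected_and_card.2 ⟨hc, ?_⟩
    rw [← hcard]
    exact card_edgeSet_deleteEdges_singleton (p.edges_subset_edgeSet he)
  refine isUnicyclic_of_forall_mem_edges hG (u := x) (v := y) (fun w q hq => ?_) ⟨v, p, hp⟩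
  by_contra hne
  exact hT.isAcyclic _ (hq.toDeleteEdges G {s(x, y)}
    (fun e he' => by rw [Set.mem_singleton_iff]; rintro rfl; exact hne he'))

end EdgeCount

/-! ### Leaves, cycles, and paths to a cycle -/

section LocalStructure

open scoped Classical

variable {V : Type*} {G : SimpleGraph V}

theorem SimpleGraph.Walk.IsCycle.exists_ne_mem_edges {u x : V} {c : G.Walk u u} (hc : c.IsCycle)
    (hx : x ∈ c.support) : ∃ y z, y ≠ z ∧ s(x, y) ∈ c.edges ∧ s(x, z) ∈ c.edges := by
  obtain ⟨y, z, hyz, h⟩ := Set.ncard_eq_two.1 (hc.ncard_neighborSet_toSubgraph_eq_two hx)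
  refine ⟨y, z, hyz, ?_, ?_⟩ <;>
    rw [← SimpleGraph.Walk.adj_toSubgraph_iff_mem_edges, ← SimpleGraph.Subgraph.mem_neighborSet, h]
      <;> simp

theorem SimpleGraph.Walk.IsPath.exists_ne_mem_edges {a b x : V} {q : G.Walk a b} (hq : q.IsPath)
    (hx : x ∈ q.support) (hxa : x ≠ a) (hxb : x ≠ b) :
    ∃ y z, y ≠ z ∧ s(x, y) ∈ q.edges ∧ s(x, z) ∈ q.edges := by
  obtain ⟨i, rfl, hi⟩ := SimpleGraph.Walk.mem_support_iff_exists_getVert.1 hx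
  have h0 : i ≠ 0 := by
    rintro rfl
    exact hxa q.getVert_zero
  have h1 : i < q.length := by
    refine lt_of_le_of_ne hi ?_
    rintro rfl
    exact hxb q.getVert_length
  obtain ⟨y, z, hyz, h⟩ := Set.ncard_eq_two.1 (hq.ncard_neighborSet_toSubgraph_internal_eq_two h0 h1)
  refine ⟨y, z, hyz, ?_, ?_⟩ <;>
    rw [← SimpleGraph.Walk.adj_toSubgraph_iff_mem_edges, ← SimpleGraph.Subgraph.mem_neighborSet, h]
      <;> simp

theorem SimpleGraph.Walk.exists_isPath_to_set {S : Set V} {a u : V} (p : G.Walk a u) (hu : u ∈ S) :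
    ∃ b ∈ S, ∃ q : G.Walk a b, q.IsPath ∧ ∀ x ∈ q.support, x ∈ S → x = b := by
  induction p with
  | nil => exact ⟨_, hu, .nil, .nil, by simp⟩
  | @cons a a' u h p ih =>
    by_cases ha : a ∈ S
    · exact ⟨a, ha, .nil, .nil, by simp⟩
    · obtain ⟨b, hb, q, -, hqS⟩ := ih hu
      refine ⟨b, hb, (SimpleGraph.Walk.cons h q).bypass, SimpleGraph.Walk.bypass_isPath _, ?_⟩
      intro x hx hxS
      have := SimpleGraph.Walk.support_bypass_subset_support _ hx
      rw [SimpleGraph.Walk.support_cons, List.mem_cons] at this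
      rcases this with rfl | h
      · exact absurd hxS ha
      · exact hqS x h hxS

/-- The vertex `b` where a path from outside reaches a cycle has one neighbour on the path and two
on the cycle. -/
theorem SimpleGraph.Walk.IsCycle.exists_three_neighbors {a b u : V} {q : G.Walk a b}
    {c : G.Walk u u} (hc : c.IsCycle) (hb : b ∈ c.support) (ha : a ∉ c.support)
    (hqc : ∀ x ∈ q.support, x ∈ c.support → x = b) :
    ∃ p y z, ({p, y, z} : Finset V).card = 3 ∧ s(b, p) ∈ q.edges ∧ s(b, y) ∈ c.edges ∧
      s(b, z) ∈ c.edges := by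
  have hnil : ¬ q.Nil := fun h => ha (h.eq ▸ hb)
  obtain ⟨y, z, hyz, hy, hz⟩ := hc.exists_ne_mem_edges hb
  have hpb : q.penultimate ≠ b := (q.adj_penultimate hnil).ne
  have hpc : q.penultimate ∉ c.support := fun h => hpb (hqc _ (q.getVert_mem_support _) h)
  refine ⟨q.penultimate, y, z, Finset.card_eq_three.2 ⟨_, _, _, ?_, ?_, hyz, rfl⟩, ?_, hy, hz⟩
  · exact fun h => hpc (h ▸ c.snd_mem_support_of_mem_edges hy)
  · exact fun h => hpc (h ▸ c.snd_mem_support_of_mem_edges hz)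
  · rw [Sym2.eq_swap]
    exact SimpleGraph.Walk.mk_penultimate_end_mem_edges hnil

variable [Fintype V]

theorem SimpleGraph.card_le_degree {x : V} {s : Finset V} (h : ∀ y ∈ s, G.Adj x y) :
    s.card ≤ G.degree x := by
  rw [← G.card_neighborFinset_eq_degree]
  exact Finset.card_le_card fun y hy => by simpa using h y hy

/-- The neighbours of `v` that have degree `1`. -/
noncomputable def SimpleGraph.leafNeighbors (G : SimpleGraph V) (v : V) : Finset V :=
  {w ∈ G.neighborFinset v | G.degree w = 1}

theorem SimpleGraph.mem_leafNeighbors {v w : V} :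
    w ∈ G.leafNeighbors v ↔ G.Adj v w ∧ G.degree w = 1 := by
  simp [SimpleGraph.leafNeighbors]

theorem SimpleGraph.card_leafNeighbors_add_le {v : V} {s : Finset V}
    (hs : ∀ y ∈ s, G.Adj v y ∧ G.degree y ≠ 1) :
    (G.leafNeighbors v).card + s.card ≤ G.degree v := by
  rw [← Finset.card_union_of_disjoint]
  · refine SimpleGraph.card_le_degree fun y hy => ?_
    rcases Finset.mem_union.1 hy with h | h
    · exact (SimpleGraph.mem_leafNeighbors.1 h).1
    · exact (hs y h).1
  · rw [Finset.disjoint_left]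
    exact fun y hy hy' => (hs y hy').2 (SimpleGraph.mem_leafNeighbors.1 hy).2

theorem SimpleGraph.two_le_degree {x y z : V} (hyz : y ≠ z) (hy : G.Adj x y) (hz : G.Adj x z) :
    2 ≤ G.degree x := by
  rw [← Finset.card_pair hyz]
  exact SimpleGraph.card_le_degree (by simp [hy, hz])

theorem SimpleGraph.Walk.IsCycle.two_le_degree {u x : V} {c : G.Walk u u} (hc : c.IsCycle)
    (hx : x ∈ c.support) : 2 ≤ G.degree x := by
  obtain ⟨y, z, hyz, hy, hz⟩ := hc.exists_ne_mem_edges hx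
  exact SimpleGraph.two_le_degree hyz (c.adj_of_mem_edges hy) (c.adj_of_mem_edges hz)

theorem SimpleGraph.Walk.IsPath.two_le_degree {a b x : V} {q : G.Walk a b} (hq : q.IsPath)
    (hx : x ∈ q.support) (hxa : x ≠ a) (hxb : x ≠ b) : 2 ≤ G.degree x := by
  obtain ⟨y, z, hyz, hy, hz⟩ := hq.exists_ne_mem_edges hx hxa hxb
  exact SimpleGraph.two_le_degree hyz (q.adj_of_mem_edges hy) (q.adj_of_mem_edges hz)

theorem SimpleGraph.Walk.IsCycle.card_leafNeighbors_add_two_le {u x : V} {c : G.Walk u u}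
    (hc : c.IsCycle) (hx : x ∈ c.support) : (G.leafNeighbors x).card + 2 ≤ G.degree x := by
  obtain ⟨y, z, hyz, hy, hz⟩ := hc.exists_ne_mem_edges hx
  rw [← Finset.card_pair hyz]
  refine SimpleGraph.card_leafNeighbors_add_le fun w hw => ?_
  have hw : s(x, w) ∈ c.edges := by
    rcases Finset.mem_insert.1 hw with rfl | hw
    · exact hy
    · rw [Finset.mem_singleton.1 hw]
      exact hz
  have := hc.two_le_degree (c.snd_mem_support_of_mem_edges hw)
  exact ⟨c.adj_of_mem_edges hw, by omega⟩

/-- The second vertex of a path that ends on a cycle is not a leaf. -/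
theorem SimpleGraph.Walk.IsPath.degree_snd_ne_one {a b u : V} {q : G.Walk a b} {c : G.Walk u u}
    (hq : q.IsPath) (hc : c.IsCycle) (hb : b ∈ c.support) (hab : a ≠ b) : G.degree q.snd ≠ 1 := by
  have hnil : ¬ q.Nil := fun h => hab h.eq
  by_cases h : q.snd = b
  · have := hc.two_le_degree hb
    rw [h]
    omega
  · have := hq.two_le_degree (q.getVert_mem_support 1) (q.adj_snd hnil).ne' h
    have h2 : 2 ≤ G.degree q.snd := this
    omega

theorem SimpleGraph.Connected.card_leafNeighbors_lt_degree {u : V} {c : G.Walk u u}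
    (hG : G.Connected) (hc : c.IsCycle) (x : V) : (G.leafNeighbors x).card < G.degree x := by
  obtain ⟨b, hb, q, hq, -⟩ := (hG x u).some.exists_isPath_to_set (S := {y | y ∈ c.support})
    c.start_mem_support
  by_cases hxb : x = b
  · subst hxb
    have := hc.card_leafNeighbors_add_two_le hb
    omega
  · have := SimpleGraph.card_leafNeighbors_add_le (G := G) (v := x) (s := {q.snd}) (by
      intro y hy
      rw [Finset.mem_singleton.1 hy]
      exact ⟨q.adj_snd fun h => hxb h.eq, hq.degree_snd_ne_one hc hb hxb⟩)
    simpa using this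

theorem SimpleGraph.Walk.IsCycle.card_leafNeighbors_add_three_le {a b u : V} {q : G.Walk a b}
    {c : G.Walk u u} (hc : c.IsCycle) (hq : q.IsPath) (hb : b ∈ c.support) (ha : a ∉ c.support)
    (hqc : ∀ x ∈ q.support, x ∈ c.support → x = b) (hda : G.degree a ≠ 1) :
    (G.leafNeighbors b).card + 3 ≤ G.degree b := by
  obtain ⟨p, y, z, hcard, hp, hy, hz⟩ := hc.exists_three_neighbors hb ha hqc
  rw [← hcard]
  refine SimpleGraph.card_leafNeighbors_add_le fun w hw => ?_
  simp only [Finset.mem_insert, Finset.mem_singleton] at hw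
  rcases hw with rfl | rfl | rfl
  · refine ⟨q.adj_of_mem_edges hp, ?_⟩
    by_cases h : w = a
    · rwa [h]
    · have := hq.two_le_degree (q.snd_mem_support_of_mem_edges hp) h (q.adj_of_mem_edges hp).ne'
      omega
  · have := hc.two_le_degree (c.snd_mem_support_of_mem_edges hy)
    exact ⟨c.adj_of_mem_edges hy, by omega⟩
  · have := hc.two_le_degree (c.snd_mem_support_of_mem_edges hz)
    exact ⟨c.adj_of_mem_edges hz, by omega⟩

end LocalStructure

/-! ### The index in terms of degree excesses -/

section Excess

open scoped Classical

variable {V : Type*} [Fintype V] {G : SimpleGraph V}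

/-- The amount by which the degree of `v` exceeds `2`; it is `0` when the degree is at most `2`, by
truncated subtraction. -/
noncomputable def SimpleGraph.excess (G : SimpleGraph V) (v : V) : ℕ := G.degree v - 2

/-- The share of `v` in the index, beyond what a vertex of degree `2` contributes: the leaves are
charged to the vertices of degree at least `3`. -/
noncomputable def SimpleGraph.vertexShare (lam : ℝ) (G : SimpleGraph V) (v : V) : ℝ :=
  (2 + lam) * (G.excess v * (G.excess v + 1)) - (G.leafNeighbors v).card * G.excess v

/-- The sum over the edges `ab` of the product of the degree excesses of `a` and `b`. -/
noncomputable def SimpleGraph.excessProduct (G : SimpleGraph V) : ℝ :=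
  ∑ e ∈ G.edgeFinset, Sym2.lift ⟨fun a b => (G.excess a : ℝ) * G.excess b,
    fun _ _ => mul_comm _ _⟩ e

theorem SimpleGraph.sum_edgeFinset_add_swap (G : SimpleGraph V) (h : V → V → ℝ) :
    ∑ e ∈ G.edgeFinset, Sym2.lift ⟨fun a b => h a b + h b a, fun _ _ => add_comm _ _⟩ e =
      ∑ a, ∑ b ∈ G.neighborFinset a, h a b := by
  have h1 : ∑ d : G.Dart, h d.fst d.snd =
      ∑ e ∈ G.edgeFinset, Sym2.lift ⟨fun a b => h a b + h b a, fun _ _ => add_comm _ _⟩ e := by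
    rw [← Finset.sum_fiberwise_of_maps_to (s := Finset.univ) (t := G.edgeFinset)
      (g := SimpleGraph.Dart.edge) (fun d _ => by
        rw [SimpleGraph.mem_edgeFinset]; exact d.edge_mem)]
    refine Finset.sum_congr rfl fun e he => ?_
    rw [SimpleGraph.mem_edgeFinset] at he
    induction e with | h x y =>
    let d : G.Dart := ⟨(x, y), he⟩
    have hd : ({d' : G.Dart | d'.edge = s(x, y)} : Finset _) = {d, d.symm} := d.edge_fiber
    rw [hd, Finset.sum_pair d.symm_ne.symm]
    rfl
  have h2 : ∑ d : G.Dart, h d.fst d.snd = ∑ a, ∑ b ∈ G.neighborFinset a, h a b := by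
    rw [← Finset.sum_fiberwise_of_maps_to (s := Finset.univ) (t := Finset.univ)
      (g := fun d : G.Dart => d.fst) (fun d _ => Finset.mem_univ _)]
    refine Finset.sum_congr rfl fun a _ => ?_
    refine Finset.sum_bij' (fun d _ => d.snd) (fun b hb => ⟨(a, b), by simpa using hb⟩)
      ?_ ?_ ?_ ?_ ?_
    · intro d hd
      simp only [Finset.mem_filter, Finset.mem_univ, true_and] at hd
      subst hd
      simp
    · intro b hb
      simp
    · intro d hd
      simp only [Finset.mem_filter, Finset.mem_univ, true_and] at hd
      subst hd
      rfl
    · intro b hb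
      rfl
    · intro d hd
      simp only [Finset.mem_filter, Finset.mem_univ, true_and] at hd
      subst hd
      rfl
  rw [← h1, h2]

theorem SimpleGraph.sum_degree_sub_two (hcard : Nat.card G.edgeSet = Nat.card V) :
    ∑ v, ((G.degree v : ℝ) - 2) = 0 := by
  have h := G.sum_degrees_eq_twice_card_edges
  have h2 : G.edgeFinset.card = Fintype.card V := by
    rw [← Nat.card_eq_fintype_card, ← hcard, Nat.card_eq_fintype_card,
      ← SimpleGraph.edgeFinset_card]
  rw [h2] at h
  have h3 : ∑ v, (G.degree v : ℝ) = 2 * Fintype.card V := by exact_mod_cast h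
  rw [Finset.sum_sub_distrib, h3]
  simp
  ring

/-- With as many edges as vertices, the degrees minus `2` add up to `0`, so the terms linear in
them cancel, and the number of leaves is the sum of the degree excesses. -/
theorem GRM_eq_sum_vertexShare (lam : ℝ) (hcard : Nat.card G.edgeSet = Nat.card V)
    (hlt : ∀ v, (G.leafNeighbors v).card < G.degree v) :
    GRM lam G = Fintype.card V * (2 + lam) ^ 2 + ∑ v, G.vertexShare lam v + G.excessProduct := by
  set z : V → ℝ := fun v => if G.degree v = 1 then 1 else 0 with hz
  set y : V → ℝ := fun v => G.excess v with hy
  have hd : ∀ v, (G.degree v : ℝ) = 2 + y v - z v := by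
    intro v
    have := hlt v
    simp only [hy, hz, SimpleGraph.excess]
    split_ifs with h
    · simp [h]; norm_num
    · rw [Nat.cast_sub (by omega)]
      push_cast
      ring
  have hyz : ∀ v, y v * z v = 0 := by
    intro v
    simp only [hy, hz, SimpleGraph.excess]
    split_ifs with h
    · simp [h]
    · simp
  have hzz : ∀ v, z v * z v = z v := by
    intro v
    simp only [hz]
    split_ifs <;> simp
  have hadj : ∀ a b, G.Adj a b → z a * z b = 0 := by
    intro a b hab
    simp only [hz]
    split_ifs with h1 h2
    · have h3 := hlt a
      have h4 : b ∈ G.leafNeighbors a := SimpleGraph.mem_leafNeighbors.2 ⟨hab, h2⟩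
      have := Finset.card_pos.2 ⟨b, h4⟩
      omega
    all_goals simp
  have hleaf : ∀ a, ∑ b ∈ G.neighborFinset a, z b = (G.leafNeighbors a).card := by
    intro a
    simp only [hz, SimpleGraph.leafNeighbors]
    rw [Finset.sum_boole]
  have hedge : GRM lam G = ∑ e ∈ G.edgeFinset, ((2 + lam) ^ 2 +
      Sym2.lift ⟨fun a b => ((2 + lam) * (y a - z a) - y a * z b) +
        ((2 + lam) * (y b - z b) - y b * z a), fun _ _ => add_comm _ _⟩ e +
      Sym2.lift ⟨fun a b => (G.excess a : ℝ) * G.excess b, fun _ _ => mul_comm _ _⟩ e) := by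
    unfold GRM
    refine Finset.sum_congr rfl fun e he => ?_
    rw [SimpleGraph.mem_edgeFinset] at he
    induction e with | h a b =>
    have := hadj a b he
    simp only [Sym2.lift_mk, hd]
    change _ = _ + _ + y a * y b
    linear_combination this
  have hcard' : G.edgeFinset.card = Fintype.card V := by
    rw [← Nat.card_eq_fintype_card, ← hcard, Nat.card_eq_fintype_card,
      ← SimpleGraph.edgeFinset_card]
  rw [hedge, Finset.sum_add_distrib, Finset.sum_add_distrib, Finset.sum_const, hcard',
    nsmul_eq_mul, G.sum_edgeFinset_add_swap fun a b => (2 + lam) * (y a - z a) - y a * z b]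
  have hzero : ∑ v, (y v - z v) = 0 := by
    rw [← SimpleGraph.sum_degree_sub_two hcard]
    exact Finset.sum_congr rfl fun v _ => by rw [hd]; ring
  have hsum : ∑ a, ∑ b ∈ G.neighborFinset a, ((2 + lam) * (y a - z a) - y a * z b) =
      ∑ v, G.vertexShare lam v := by
    have : ∀ a, ∑ b ∈ G.neighborFinset a, ((2 + lam) * (y a - z a) - y a * z b) =
        G.vertexShare lam a + (2 + lam) * (y a - z a) := by
      intro a
      rw [Finset.sum_sub_distrib, Finset.sum_const, SimpleGraph.card_neighborFinset_eq_degree,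
        nsmul_eq_mul, ← Finset.mul_sum, hleaf, hd]
      change _ = (2 + lam) * (y a * (y a + 1)) - _ * y a + _
      linear_combination (2 + lam) * (hzz a - 2 * hyz a)
    rw [Finset.sum_congr rfl fun a _ => this a, Finset.sum_add_distrib, ← Finset.mul_sum, hzero]
    ring
  rw [hsum]
  rfl

theorem SimpleGraph.excessProduct_nonneg (G : SimpleGraph V) : 0 ≤ G.excessProduct := by
  refine Finset.sum_nonneg fun e _ => ?_
  induction e with | h a b =>
  simp only [Sym2.lift_mk]
  positivity

theorem SimpleGraph.mul_excess_le_excessProduct {a b : V} (hab : G.Adj a b) :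
    (G.excess a : ℝ) * G.excess b ≤ G.excessProduct := by
  have := Finset.single_le_sum (s := G.edgeFinset)
    (f := Sym2.lift ⟨fun a b => (G.excess a : ℝ) * G.excess b, fun _ _ => mul_comm _ _⟩)
    (a := s(a, b)) (fun e _ => by
      induction e with | h a b =>
      simp only [Sym2.lift_mk]
      positivity) (by rwa [SimpleGraph.mem_edgeFinset])
  rw [Sym2.lift_mk] at this
  exact this

theorem SimpleGraph.excessProduct_eq_zero
    (h : ∀ a b, G.Adj a b → G.excess a = 0 ∨ G.excess b = 0) : G.excessProduct = 0 := by
  refine Finset.sum_eq_zero fun e he => ?_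
  rw [SimpleGraph.mem_edgeFinset] at he
  induction e with | h a b =>
  simp only [Sym2.lift_mk]
  rcases h a b he with h | h <;> simp [h]

theorem SimpleGraph.vertexShare_of_excess_eq_zero {lam : ℝ} {v : V} (h : G.excess v = 0) :
    G.vertexShare lam v = 0 := by
  simp [SimpleGraph.vertexShare, h]

/-- At most `excess v + 1` of the neighbours of `v` are leaves, so a vertex of degree at least `3`
has a positive share as soon as `1 < 2 + lam`. -/
theorem SimpleGraph.vertexShare_pos {lam : ℝ} (hlam : -1 / 2 ≤ lam) {v : V}
    (hlt : (G.leafNeighbors v).card < G.degree v) (h : G.excess v ≠ 0) :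
    0 < G.vertexShare lam v := by
  have h1 : (G.leafNeighbors v).card ≤ G.excess v + 1 := by
    unfold SimpleGraph.excess at *
    omega
  have h1' : ((G.leafNeighbors v).card : ℝ) ≤ G.excess v + 1 := by exact_mod_cast h1
  have h2 : (1 : ℝ) ≤ G.excess v := by exact_mod_cast Nat.one_le_iff_ne_zero.2 h
  unfold SimpleGraph.vertexShare
  have h3 := mul_le_mul_of_nonneg_right h1' (by linarith : (0 : ℝ) ≤ G.excess v)
  have h4 : 0 < (1 + lam) * (G.excess v * (G.excess v + 1) : ℝ) :=
    mul_pos (by linarith) (by positivity)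
  linarith

theorem SimpleGraph.vertexShare_nonneg {lam : ℝ} (hlam : -1 / 2 ≤ lam) {v : V}
    (hlt : (G.leafNeighbors v).card < G.degree v) : 0 ≤ G.vertexShare lam v := by
  by_cases h : G.excess v = 0
  · rw [SimpleGraph.vertexShare_of_excess_eq_zero h]
  · exact (SimpleGraph.vertexShare_pos hlam hlt h).le

end Excess

/-! ### Recognizing the extremal graphs by their degrees -/

section Recognition

open scoped Classical

variable {V : Type*} [Fintype V] {G : SimpleGraph V} {Δ : ℕ}

/-- If a relation `R` contained in the adjacency of a connected graph already exhausts the degrees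
of the vertices of a nonempty set `S`, without leaving `S`, then `S` is everything and `R` is the
adjacency. -/
theorem SimpleGraph.Connected.forall_mem_and_adj_iff (hG : G.Connected) {S : Set V}
    {R : V → V → Prop} (hS : S.Nonempty) (hR : ∀ x y, R x y → G.Adj x y)
    (hdeg : ∀ x ∈ S, ∃ s : Finset V, (∀ y ∈ s, R x y ∧ y ∈ S) ∧ G.degree x ≤ s.card) :
    (∀ x, x ∈ S) ∧ ∀ x y, G.Adj x y ↔ R x y := by
  have key : ∀ x ∈ S, ∀ y, G.Adj x y → R x y ∧ y ∈ S := by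
    intro x hx y hxy
    obtain ⟨s, hs, hcard⟩ := hdeg x hx
    have hsub : s ⊆ G.neighborFinset x := fun w hw => by simpa using hR _ _ (hs w hw).1
    rw [← G.card_neighborFinset_eq_degree] at hcard
    have := Finset.eq_of_subset_of_card_le hsub hcard
    exact hs y (by rw [this]; simpa using hxy)
  have hall : ∀ x, x ∈ S := by
    obtain ⟨a, ha⟩ := hS
    intro x
    obtain ⟨p⟩ := hG a x
    induction p with
    | nil => exact ha
    | cons h p ih => exact ih (key _ ha _ h).2
  exact ⟨hall, fun x y => ⟨fun h => (key x (hall x) y h).1, hR x y⟩⟩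

theorem SimpleGraph.degree_le_two_of_excess_eq_zero {x : V} (h : G.excess x = 0) :
    G.degree x ≤ 2 := by
  unfold SimpleGraph.excess at h
  omega

theorem mem_starOnCycleGraphs_of_excess {a : V} (hΔ : 3 ≤ Δ) (hG : G ∈ unicyclicGraphs V Δ)
    (ha : G.degree a = Δ) (hL : Δ ≤ (G.leafNeighbors a).card + 2)
    (h0 : ∀ x, x ≠ a → G.excess x = 0) : G ∈ starOnCycleGraphs V Δ := by
  obtain ⟨hconn, C, ⟨u, c, hc, -⟩, -⟩ := hG.1
  have hac : a ∈ c.support := by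
    by_contra hac
    obtain ⟨b, hb, q, hq, hqc⟩ := (hconn a u).some.exists_isPath_to_set
      (S := {y | y ∈ c.support}) c.start_mem_support
    have := hc.card_leafNeighbors_add_three_le hq hb hac hqc (by omega)
    have := SimpleGraph.degree_le_two_of_excess_eq_zero (h0 b fun h => hac (h ▸ hb))
    omega
  have hc' : (c.rotate a hac).IsCycle := by simpa using hc
  generalize c.rotate a hac = d at hc'
  have hle := hc'.card_leafNeighbors_add_two_le d.start_mem_support
  have hLd : ∀ x ∈ G.leafNeighbors a, x ∉ d.support := fun x hx hxd => by
    have := hc'.two_le_degree hxd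
    have := (SimpleGraph.mem_leafNeighbors.1 hx).2
    omega
  have key := hconn.forall_mem_and_adj_iff (S := {x | x ∈ d.support ∨ x ∈ G.leafNeighbors a})
    (R := fun x y => s(x, y) ∈ d.edges ∨ (x = a ∧ y ∈ G.leafNeighbors a) ∨
      (y = a ∧ x ∈ G.leafNeighbors a)) ⟨a, Or.inl d.start_mem_support⟩ ?_ ?_
  · exact ⟨hG, a, d, G.leafNeighbors a, hc', by omega, hLd, key.1, key.2⟩
  · rintro x y (h | ⟨rfl, h⟩ | ⟨rfl, h⟩)
    · exact d.adj_of_mem_edges h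
    · exact (SimpleGraph.mem_leafNeighbors.1 h).1
    · exact (SimpleGraph.mem_leafNeighbors.1 h).1.symm
  · rintro x (hx | hx)
    · obtain ⟨y, z, hyz, hy, hz⟩ := hc'.exists_ne_mem_edges hx
      have hyd := d.snd_mem_support_of_mem_edges hy
      have hzd := d.snd_mem_support_of_mem_edges hz
      by_cases hxa : x = a
      · subst hxa
        refine ⟨G.leafNeighbors x ∪ {y, z}, ?_, ?_⟩
        · intro w hw
          simp only [Finset.mem_union, Finset.mem_insert, Finset.mem_singleton] at hw
          rcases hw with hw | rfl | rfl
          · exact ⟨.inr (.inl ⟨rfl, hw⟩), .inr hw⟩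
          · exact ⟨.inl hy, .inl hyd⟩
          · exact ⟨.inl hz, .inl hzd⟩
        · rw [Finset.card_union_of_disjoint, Finset.card_pair hyz]
          · omega
          · rw [Finset.disjoint_left]
            intro w hw hw'
            simp only [Finset.mem_insert, Finset.mem_singleton] at hw'
            rcases hw' with rfl | rfl
            · exact hLd _ hw hyd
            · exact hLd _ hw hzd
      · refine ⟨{y, z}, ?_, ?_⟩
        · intro w hw
          simp only [Finset.mem_insert, Finset.mem_singleton] at hw
          rcases hw with rfl | rfl
          · exact ⟨.inl hy, .inl hyd⟩
          · exact ⟨.inl hz, .inl hzd⟩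
        · rw [Finset.card_pair hyz]
          exact SimpleGraph.degree_le_two_of_excess_eq_zero (h0 x hxa)
    · refine ⟨{a}, ?_, ?_⟩
      · intro w hw
        rw [Finset.mem_singleton.1 hw]
        exact ⟨.inr (.inr ⟨rfl, hx⟩), .inl d.start_mem_support⟩
      · rw [(SimpleGraph.mem_leafNeighbors.1 hx).2, Finset.card_singleton]

theorem mem_starPathCycleGraphs_of_excess {a b : V} (hΔ : 3 ≤ Δ) (hG : G ∈ unicyclicGraphs V Δ)
    (ha : G.degree a = Δ) (hL : Δ ≤ (G.leafNeighbors a).card + 1) (hab : ¬ G.Adj a b)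
    (hb : G.degree b ≤ 3) (h0 : ∀ x, x ≠ a → x ≠ b → G.excess x = 0) :
    G ∈ starPathCycleGraphs V Δ := by
  obtain ⟨hconn, C, ⟨u, c, hc, -⟩, -⟩ := hG.1
  have hac : a ∉ c.support := fun hac => by
    have := hc.card_leafNeighbors_add_two_le hac
    omega
  obtain ⟨b', hb', q, hq, hqc⟩ := (hconn a u).some.exists_isPath_to_set
    (S := {y | y ∈ c.support}) c.start_mem_support
  have hab' : a ≠ b' := fun h => hac (h ▸ hb')
  have hbb : b' = b := by
    by_contra hne
    have := hc.card_leafNeighbors_add_three_le hq hb' hac hqc (by omega)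
    have := SimpleGraph.degree_le_two_of_excess_eq_zero (h0 b' hab'.symm hne)
    omega
  subst hbb
  have hc' : (c.rotate b' hb').IsCycle := by simpa using hc
  have hmem : ∀ x, x ∈ c.support ↔ x ∈ (c.rotate b' hb').support := fun x => by
    rw [← SimpleGraph.Walk.mem_verts_toSubgraph, ← SimpleGraph.Walk.mem_verts_toSubgraph,
      SimpleGraph.Walk.toSubgraph_rotate]
  simp only [hmem] at hac
  replace hqc : ∀ x ∈ q.support, x ∈ (c.rotate b' hb').support → x = b' :=
    fun x hx hxc => hqc x hx ((hmem x).2 hxc)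
  generalize c.rotate b' hb' = d at hc' hac hqc
  clear hmem
  have hnil : ¬ q.Nil := fun h => hab' h.eq
  have hlen : 2 ≤ q.length := by
    have h1 : q.length ≠ 0 := fun h => hnil (SimpleGraph.Walk.length_eq_zero_iff.1 h)
    have h2 : q.length ≠ 1 := fun h => hab (SimpleGraph.Walk.adj_of_length_eq_one h)
    omega
  have hlt := hconn.card_leafNeighbors_lt_degree hc' a
  have hLd : ∀ x ∈ G.leafNeighbors a, x ∉ d.support := fun x hx hxd => by
    have := hc'.two_le_degree hxd
    have := (SimpleGraph.mem_leafNeighbors.1 hx).2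
    omega
  have hLq : ∀ x ∈ q.support, x ∉ G.leafNeighbors a := fun x hxq hx => by
    have h1 := (SimpleGraph.mem_leafNeighbors.1 hx).2
    have h2 := hq.two_le_degree hxq (SimpleGraph.mem_leafNeighbors.1 hx).1.ne'
      (fun h => hLd x hx (h ▸ d.start_mem_support))
    omega
  have key := hconn.forall_mem_and_adj_iff
    (S := {x | x ∈ d.support ∨ x ∈ q.support ∨ x ∈ G.leafNeighbors a})
    (R := fun x y => s(x, y) ∈ d.edges ∨ s(x, y) ∈ q.edges ∨ (x = a ∧ y ∈ G.leafNeighbors a) ∨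
      (y = a ∧ x ∈ G.leafNeighbors a)) ⟨b', Or.inl d.start_mem_support⟩ ?_ ?_
  · exact ⟨hG, a, b', d, q, G.leafNeighbors a, hc', hq, hlen, by omega, hac, hLd, hqc, hLq,
      key.1, key.2⟩
  · rintro x y (h | h | ⟨rfl, h⟩ | ⟨rfl, h⟩)
    · exact d.adj_of_mem_edges h
    · exact q.adj_of_mem_edges h
    · exact (SimpleGraph.mem_leafNeighbors.1 h).1
    · exact (SimpleGraph.mem_leafNeighbors.1 h).1.symm
  · intro x hx
    by_cases hxa : x = a
    · subst hxa
      refine ⟨insert q.snd (G.leafNeighbors x), ?_, ?_⟩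
      · intro w hw
        rcases Finset.mem_insert.1 hw with rfl | hw
        · exact ⟨.inr (.inl (SimpleGraph.Walk.mk_start_snd_mem_edges hnil)),
            .inr (.inl (q.getVert_mem_support 1))⟩
        · exact ⟨.inr (.inr (.inl ⟨rfl, hw⟩)), .inr (.inr hw)⟩
      · rw [Finset.card_insert_of_notMem (hLq _ (q.getVert_mem_support 1))]
        omega
    by_cases hxb : x = b'
    · subst hxb
      obtain ⟨p, y, z, hcard, hp, hy, hz⟩ := hc'.exists_three_neighbors d.start_mem_support hac hqc
      refine ⟨{p, y, z}, ?_, hcard ▸ hb⟩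
      intro w hw
      simp only [Finset.mem_insert, Finset.mem_singleton] at hw
      rcases hw with rfl | rfl | rfl
      · exact ⟨.inr (.inl hp), .inr (.inl (q.snd_mem_support_of_mem_edges hp))⟩
      · exact ⟨.inl hy, .inl (d.snd_mem_support_of_mem_edges hy)⟩
      · exact ⟨.inl hz, .inl (d.snd_mem_support_of_mem_edges hz)⟩
    have hx2 := SimpleGraph.degree_le_two_of_excess_eq_zero (h0 x hxa hxb)
    rcases hx with hx | hx | hx
    · obtain ⟨y, z, hyz, hy, hz⟩ := hc'.exists_ne_mem_edges hx
      refine ⟨{y, z}, ?_, by rwa [Finset.card_pair hyz]⟩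
      intro w hw
      simp only [Finset.mem_insert, Finset.mem_singleton] at hw
      rcases hw with rfl | rfl
      · exact ⟨.inl hy, .inl (d.snd_mem_support_of_mem_edges hy)⟩
      · exact ⟨.inl hz, .inl (d.snd_mem_support_of_mem_edges hz)⟩
    · obtain ⟨y, z, hyz, hy, hz⟩ := hq.exists_ne_mem_edges hx hxa hxb
      refine ⟨{y, z}, ?_, by rwa [Finset.card_pair hyz]⟩
      intro w hw
      simp only [Finset.mem_insert, Finset.mem_singleton] at hw
      rcases hw with rfl | rfl
      · exact ⟨.inr (.inl hy), .inr (.inl (q.snd_mem_support_of_mem_edges hy))⟩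
      · exact ⟨.inr (.inl hz), .inr (.inl (q.snd_mem_support_of_mem_edges hz))⟩
    · refine ⟨{a}, ?_, ?_⟩
      · intro w hw
        rw [Finset.mem_singleton.1 hw]
        exact ⟨.inr (.inr (.inr ⟨rfl, hx⟩)), .inr (.inl q.start_mem_support)⟩
      · rw [(SimpleGraph.mem_leafNeighbors.1 hx).2, Finset.card_singleton]

end Recognition

/-! ### Values and lower bounds of the index -/

section Bounds

open scoped Classical

variable {V : Type*} [Fintype V] {G : SimpleGraph V} {Δ : ℕ} {lam : ℝ}

theorem IsUnicyclic.card_leafNeighbors_lt_degree (hG : IsUnicyclic G) (v : V) :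
    (G.leafNeighbors v).card < G.degree v := by
  obtain ⟨hconn, C, ⟨u, c, hc, -⟩, -⟩ := hG
  exact hconn.card_leafNeighbors_lt_degree hc v

theorem IsUnicyclic.GRM_eq (hG : IsUnicyclic G) (lam : ℝ) :
    GRM lam G = Fintype.card V * (2 + lam) ^ 2 + ∑ v, G.vertexShare lam v + G.excessProduct :=
  GRM_eq_sum_vertexShare lam hG.card_edgeSet hG.card_leafNeighbors_lt_degree

/-- Lower bounds for all degrees are equalities as soon as they add up to the sum of the degrees,
which is twice the number of vertices. -/
theorem IsUnicyclic.degree_eq (hG : IsUnicyclic G) {f : V → ℝ} (hf : ∀ v, f v ≤ G.degree v)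
    (hsum : ∑ v, (f v - 2) = 0) (v : V) : (G.degree v : ℝ) = f v := by
  have h := SimpleGraph.sum_degree_sub_two hG.card_edgeSet
  rw [← hsum] at h
  have := (Finset.sum_eq_sum_iff_of_le (s := Finset.univ) (f := fun v => f v - 2)
    (g := fun v => (G.degree v : ℝ) - 2) (fun v _ => by linarith [hf v])).1 h.symm v
    (Finset.mem_univ v)
  linarith

theorem GRM_eq_of_mem_starOnCycleGraphs (hΔ : 3 ≤ Δ) (hG : G ∈ starOnCycleGraphs V Δ) :
    GRM lam G = ((Δ : ℝ) + lam) * (Δ + Δ * lam + 2) +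
      ((Fintype.card V : ℝ) - Δ) * (2 + lam) ^ 2 := by
  obtain ⟨⟨hU, hmax⟩, a, c, L, hc, hL, hLc, hall, hadj⟩ := hG
  have haL : a ∉ L := fun h => hLc a h c.start_mem_support
  have hLa : ∀ x ∈ L, G.Adj a x := fun x hx => (hadj a x).2 (.inr (.inl ⟨rfl, hx⟩))
  have hda : Δ ≤ G.degree a := by
    obtain ⟨y, z, hyz, hy, hz⟩ := hc.exists_ne_mem_edges c.start_mem_support
    have hyc := c.snd_mem_support_of_mem_edges hy
    have hzc := c.snd_mem_support_of_mem_edges hz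
    rw [← hL, ← Finset.card_pair hyz, ← Finset.card_union_of_disjoint]
    · refine SimpleGraph.card_le_degree fun w hw => ?_
      simp only [Finset.mem_union, Finset.mem_insert, Finset.mem_singleton] at hw
      rcases hw with hw | rfl | rfl
      · exact hLa w hw
      · exact c.adj_of_mem_edges hy
      · exact c.adj_of_mem_edges hz
    · rw [Finset.disjoint_left]
      intro w hw hw'
      simp only [Finset.mem_insert, Finset.mem_singleton] at hw'
      rcases hw' with rfl | rfl
      · exact hLc _ hw hyc
      · exact hLc _ hw hzc
  have hΔ2 : (L.card : ℝ) + 2 = Δ := by exact_mod_cast hL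
  have hdeg := hU.degree_eq
    (f := fun v => 2 + (if v = a then (Δ - 2 : ℝ) else 0) - (if v ∈ L then 1 else 0)) (by
      intro v
      by_cases hva : v = a
      · subst hva
        have : (Δ : ℝ) ≤ G.degree v := by exact_mod_cast hda
        simpa [haL] using this
      · by_cases hvL : v ∈ L
        · have : 1 ≤ G.degree v := by
            have := hU.card_leafNeighbors_lt_degree v
            omega
          have : (1 : ℝ) ≤ G.degree v := by exact_mod_cast this
          simp only [hva, hvL, if_true, if_false]
          linarith
        · have : 2 ≤ G.degree v := hc.two_le_degree ((hall v).resolve_right hvL)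
          have : (2 : ℝ) ≤ G.degree v := by exact_mod_cast this
          simpa [hva, hvL] using this) (by
      have : ∀ v, (2 + (if v = a then (Δ - 2 : ℝ) else 0) - (if v ∈ L then 1 else 0)) - 2 =
          (if v = a then (Δ - 2 : ℝ) else 0) - (if v ∈ L then 1 else 0) := fun v => by ring
      rw [Finset.sum_congr rfl fun v _ => this v, Finset.sum_sub_distrib, Finset.sum_ite_eq',
        if_pos (Finset.mem_univ a), Finset.sum_boole, Finset.filter_univ_mem]
      linarith)
  have hda' : G.degree a = Δ := by
    have := hdeg a
    simp only [haL, if_true, if_false] at this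
    have : (G.degree a : ℝ) = Δ := by linarith
    exact_mod_cast this
  have hx0 : ∀ v, v ≠ a → G.excess v = 0 := by
    intro v hva
    have h1 := hdeg v
    simp only [hva, if_false] at h1
    have h2 : (G.degree v : ℝ) ≤ 2 := by
      rw [h1]
      split_ifs <;> norm_num
    have : G.degree v ≤ 2 := by exact_mod_cast h2
    unfold SimpleGraph.excess
    omega
  have hleaf : (G.leafNeighbors a).card + 2 = Δ := by
    have h1 := hc.card_leafNeighbors_add_two_le c.start_mem_support
    have h2 : L.card ≤ (G.leafNeighbors a).card := by
      refine Finset.card_le_card fun x hx => SimpleGraph.mem_leafNeighbors.2 ⟨hLa x hx, ?_⟩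
      have := hdeg x
      have hxa : x ≠ a := fun h => haL (h ▸ hx)
      simp only [hx, hxa, if_true, if_false] at this
      have : (G.degree x : ℝ) = 1 := by linarith
      exact_mod_cast this
    omega
  have hex : G.excess a + 2 = Δ := by
    unfold SimpleGraph.excess
    omega
  rw [hU.GRM_eq, SimpleGraph.excessProduct_eq_zero, Finset.sum_eq_single a]
  · have h1 : (G.excess a : ℝ) = Δ - 2 := by
      rw [← hex]
      push_cast
      ring
    have h2 : ((G.leafNeighbors a).card : ℝ) = Δ - 2 := by
      rw [← hleaf]
      push_cast
      ring
    rw [SimpleGraph.vertexShare, h1, h2]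
    ring
  · exact fun v _ hv => SimpleGraph.vertexShare_of_excess_eq_zero (hx0 v hv)
  · simp
  · intro x y hxy
    by_cases hx : x = a
    · exact .inr (hx0 y fun h => hxy.ne (hx.trans h.symm))
    · exact .inl (hx0 x hx)

theorem GRM_eq_of_mem_starPathCycleGraphs (hΔ : 3 ≤ Δ) (hG : G ∈ starPathCycleGraphs V Δ) :
    GRM lam G = ((Δ : ℝ) + lam) * (Δ + Δ * lam + 1) +
      ((Fintype.card V : ℝ) - Δ) * (2 + lam) ^ 2 + 3 * (2 + lam) := by
  obtain ⟨⟨hU, hmax⟩, a, b, c, q, L, hc, hq, hlen, hL, hac, hLc, hqc, hqL, hall, hadj⟩ := hG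
  have haL : a ∉ L := hqL a q.start_mem_support
  have hbL : b ∉ L := hqL b q.end_mem_support
  have hab : a ≠ b := fun h => hac (h ▸ c.start_mem_support)
  have hnil : ¬ q.Nil := fun h => hab h.eq
  have hLa : ∀ x ∈ L, G.Adj a x := fun x hx => (hadj a x).2 (.inr (.inr (.inl ⟨rfl, hx⟩)))
  have hnadj : ¬ G.Adj a b := by
    intro h
    rcases (hadj a b).1 h with h | h | ⟨-, h⟩ | ⟨h, -⟩
    · exact hac (c.fst_mem_support_of_mem_edges h)
    · have := hq.length_eq_one_of_mem_edges h
      omega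
    · exact hbL h
    · exact hab h.symm
  have hda : Δ ≤ G.degree a := by
    have hsnd : q.snd ∉ L := hqL _ (q.getVert_mem_support 1)
    rw [← hL, ← Finset.card_insert_of_notMem hsnd]
    refine SimpleGraph.card_le_degree fun w hw => ?_
    rcases Finset.mem_insert.1 hw with rfl | hw
    · exact q.adj_snd hnil
    · exact hLa w hw
  have hdb : 3 ≤ G.degree b := by
    have := hc.card_leafNeighbors_add_three_le hq c.start_mem_support hac hqc (by omega)
    omega
  have hΔ1 : (L.card : ℝ) + 1 = Δ := by exact_mod_cast hL
  have hdeg := hU.degree_eq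
    (f := fun v => 2 + (if v = a then (Δ - 2 : ℝ) else 0) + (if v = b then 1 else 0) -
      (if v ∈ L then 1 else 0)) (by
      intro v
      by_cases hva : v = a
      · subst hva
        have : (Δ : ℝ) ≤ G.degree v := by exact_mod_cast hda
        simpa [haL, hab] using this
      by_cases hvb : v = b
      · subst hvb
        have : (3 : ℝ) ≤ G.degree v := by exact_mod_cast hdb
        simp only [hva, hbL, if_true, if_false]
        linarith
      by_cases hvL : v ∈ L
      · have : 1 ≤ G.degree v := by
          have := hU.card_leafNeighbors_lt_degree v
          omega
        have : (1 : ℝ) ≤ G.degree v := by exact_mod_cast this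
        simp only [hva, hvb, hvL, if_true, if_false]
        linarith
      · have : 2 ≤ G.degree v := by
          rcases hall v with h | h | h
          · exact hc.two_le_degree h
          · exact hq.two_le_degree h hva hvb
          · exact absurd h hvL
        have : (2 : ℝ) ≤ G.degree v := by exact_mod_cast this
        simpa [hva, hvb, hvL] using this) (by
      have : ∀ v, (2 + (if v = a then (Δ - 2 : ℝ) else 0) + (if v = b then 1 else 0) -
          (if v ∈ L then 1 else 0)) - 2 = (if v = a then (Δ - 2 : ℝ) else 0) +
          (if v = b then 1 else 0) - (if v ∈ L then 1 else 0) := fun v => by ring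
      rw [Finset.sum_congr rfl fun v _ => this v, Finset.sum_sub_distrib, Finset.sum_add_distrib,
        Finset.sum_ite_eq', Finset.sum_ite_eq', if_pos (Finset.mem_univ a),
        if_pos (Finset.mem_univ b), Finset.sum_boole, Finset.filter_univ_mem]
      linarith)
  have hda' : G.degree a = Δ := by
    have := hdeg a
    simp only [haL, hab, if_true, if_false] at this
    have : (G.degree a : ℝ) = Δ := by linarith
    exact_mod_cast this
  have hdb' : G.degree b = 3 := by
    have := hdeg b
    simp only [hbL, hab.symm, if_true, if_false] at this
    have : (G.degree b : ℝ) = 3 := by linarith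
    exact_mod_cast this
  have hx0 : ∀ v, v ≠ a → v ≠ b → G.excess v = 0 := by
    intro v hva hvb
    have h1 := hdeg v
    simp only [hva, hvb, if_false] at h1
    have h2 : (G.degree v : ℝ) ≤ 2 := by
      rw [h1]
      split_ifs <;> norm_num
    have : G.degree v ≤ 2 := by exact_mod_cast h2
    unfold SimpleGraph.excess
    omega
  have hleaf : (G.leafNeighbors a).card + 1 = Δ := by
    have h1 := hU.card_leafNeighbors_lt_degree a
    have h2 : L.card ≤ (G.leafNeighbors a).card := by
      refine Finset.card_le_card fun x hx => SimpleGraph.mem_leafNeighbors.2 ⟨hLa x hx, ?_⟩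
      have := hdeg x
      have hxa : x ≠ a := fun h => haL (h ▸ hx)
      have hxb : x ≠ b := fun h => hbL (h ▸ hx)
      simp only [hx, hxa, hxb, if_true, if_false] at this
      have : (G.degree x : ℝ) = 1 := by linarith
      exact_mod_cast this
    omega
  have hleafb : (G.leafNeighbors b).card = 0 := by
    have := hc.card_leafNeighbors_add_three_le hq c.start_mem_support hac hqc (by omega)
    omega
  have hex : G.excess a + 2 = Δ := by
    unfold SimpleGraph.excess
    omega
  have hexb : G.excess b = 1 := by
    unfold SimpleGraph.excess
    omega
  rw [hU.GRM_eq, SimpleGraph.excessProduct_eq_zero, Finset.sum_eq_add a b hab]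
  · have h1 : (G.excess a : ℝ) = Δ - 2 := by
      rw [← hex]
      push_cast
      ring
    have h2 : ((G.leafNeighbors a).card : ℝ) = Δ - 1 := by
      rw [← hleaf]
      push_cast
      ring
    rw [SimpleGraph.vertexShare, SimpleGraph.vertexShare, h1, h2, hexb, hleafb]
    push_cast
    ring
  · exact fun v _ hv => SimpleGraph.vertexShare_of_excess_eq_zero (hx0 v hv.1 hv.2)
  · simp
  · simp
  · intro x y hxy
    by_cases hxa : x = a
    · refine .inr (hx0 y (fun h => hxy.ne (hxa.trans h.symm)) fun h => ?_)
      rw [hxa, h] at hxy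
      exact hnadj hxy
    by_cases hxb : x = b
    · refine .inr (hx0 y (fun h => ?_) fun h => hxy.ne (hxb.trans h.symm))
      rw [hxb, h] at hxy
      exact hnadj hxy.symm
    exact .inl (hx0 x hxa hxb)

/-- A vertex of maximum degree with at least two neighbours that are not leaves already has the
share that it has when it is the only vertex of degree at least `3`. -/
theorem starOnCycle_le_GRM_of_card_leafNeighbors_le (hlam : -1 / 2 ≤ lam) (hΔ : 3 ≤ Δ)
    (hG : G ∈ unicyclicGraphs V Δ) {a : V} (ha : G.degree a = Δ)
    (hL : (G.leafNeighbors a).card + 2 ≤ Δ) :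
    ((Δ : ℝ) + lam) * (Δ + Δ * lam + 2) + ((Fintype.card V : ℝ) - Δ) * (2 + lam) ^ 2 ≤ GRM lam G ∧
    (GRM lam G = ((Δ : ℝ) + lam) * (Δ + Δ * lam + 2) +
      ((Fintype.card V : ℝ) - Δ) * (2 + lam) ^ 2 → G ∈ starOnCycleGraphs V Δ) := by
  have hU := hG.1
  have hshare : ∀ v, 0 ≤ G.vertexShare lam v := fun v =>
    SimpleGraph.vertexShare_nonneg hlam (hU.card_leafNeighbors_lt_degree v)
  have hP := G.excessProduct_nonneg
  have hex : G.excess a + 2 = Δ := by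
    unfold SimpleGraph.excess
    omega
  have h1 : (Δ : ℝ) = G.excess a + 2 := by exact_mod_cast hex.symm
  have hk : (1 : ℝ) ≤ G.excess a := by
    have : 1 ≤ G.excess a := by omega
    exact_mod_cast this
  have hLk : ((G.leafNeighbors a).card : ℝ) ≤ G.excess a := by
    have : (G.leafNeighbors a).card ≤ G.excess a := by omega
    exact_mod_cast this
  have hsplit := Finset.add_sum_erase Finset.univ (G.vertexShare lam) (Finset.mem_univ a)
  have hrest : 0 ≤ ∑ v ∈ Finset.univ.erase a, G.vertexShare lam v :=
    Finset.sum_nonneg fun v _ => hshare v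
  have hdiff : GRM lam G - (((Δ : ℝ) + lam) * (Δ + Δ * lam + 2) +
      ((Fintype.card V : ℝ) - Δ) * (2 + lam) ^ 2) =
      (G.excess a - (G.leafNeighbors a).card) * G.excess a +
      ∑ v ∈ Finset.univ.erase a, G.vertexShare lam v + G.excessProduct := by
    rw [hU.GRM_eq, ← hsplit, SimpleGraph.vertexShare, h1]
    ring
  have hfirst : 0 ≤ ((G.excess a : ℝ) - (G.leafNeighbors a).card) * G.excess a :=
    mul_nonneg (by linarith) (by linarith)
  refine ⟨by linarith, fun heq => ?_⟩
  refine mem_starOnCycleGraphs_of_excess hΔ hG ha ?_ fun v hv => ?_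
  · have h2 : ((G.excess a : ℝ) - (G.leafNeighbors a).card) * G.excess a = 0 := by linarith
    rcases mul_eq_zero.1 h2 with h | h
    · have : (G.excess a : ℝ) = (G.leafNeighbors a).card := by linarith
      have : G.excess a = (G.leafNeighbors a).card := by exact_mod_cast this
      omega
    · linarith
  · by_contra hne
    have h2 := SimpleGraph.vertexShare_pos hlam (hU.card_leafNeighbors_lt_degree v) hne
    have h3 := Finset.single_le_sum (fun v _ => hshare v)
      (Finset.mem_erase.2 ⟨hv, Finset.mem_univ v⟩)
    linarith

/-- A vertex `a` of maximum degree all of whose neighbours but one are leaves lies outside the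
cycle, and the vertex `b` where the path from `a` reaches the cycle has degree at least `3`.
At least three of the neighbours of `b` are not leaves, so its share is at least `2 * (2 + lam)`.
When there are at most `Δ + 3` vertices, the path is a single edge, since otherwise `a`, its
neighbours and the cycle would be pairwise disjoint. -/
theorem starPathCycle_le_GRM_of_le_card_leafNeighbors (hlam : -1 / 2 ≤ lam) (hΔ : 3 ≤ Δ)
    (hG : G ∈ unicyclicGraphs V Δ) {a : V} (ha : G.degree a = Δ)
    (hL : Δ ≤ (G.leafNeighbors a).card + 1) :
    (((Δ : ℝ) + lam) * (Δ + Δ * lam + 1) + ((Fintype.card V : ℝ) - Δ) * (2 + lam) ^ 2 +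
      3 * (2 + lam) ≤ GRM lam G) ∧
    (GRM lam G = ((Δ : ℝ) + lam) * (Δ + Δ * lam + 1) +
      ((Fintype.card V : ℝ) - Δ) * (2 + lam) ^ 2 + 3 * (2 + lam) → G ∈ starPathCycleGraphs V Δ) ∧
    (Fintype.card V ≤ Δ + 3 → ((Δ : ℝ) + lam) * (Δ + Δ * lam + 2) +
      ((Fintype.card V : ℝ) - Δ) * (2 + lam) ^ 2 < GRM lam G) := by
  have hU := hG.1
  obtain ⟨hconn, C, ⟨u, c, hc, -⟩, -⟩ := hG.1
  have hac : a ∉ c.support := fun hac => by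
    have := hc.card_leafNeighbors_add_two_le hac
    omega
  obtain ⟨b, hb, q, hq, hqc⟩ := (hconn a u).some.exists_isPath_to_set
    (S := {y | y ∈ c.support}) c.start_mem_support
  have hab : a ≠ b := fun h => hac (h ▸ hb)
  have hLb := hc.card_leafNeighbors_add_three_le hq hb hac hqc (by omega)
  have hshare : ∀ v, 0 ≤ G.vertexShare lam v := fun v =>
    SimpleGraph.vertexShare_nonneg hlam (hU.card_leafNeighbors_lt_degree v)
  have hP := G.excessProduct_nonneg
  have hlt := hU.card_leafNeighbors_lt_degree a
  have hex : G.excess a + 2 = Δ := by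
    unfold SimpleGraph.excess
    omega
  have hexb : G.excess b + 2 = G.degree b := by
    unfold SimpleGraph.excess
    omega
  have h1 : (Δ : ℝ) = G.excess a + 2 := by exact_mod_cast hex.symm
  have hk : (1 : ℝ) ≤ G.excess a := by
    have : 1 ≤ G.excess a := by omega
    exact_mod_cast this
  have hLk : ((G.leafNeighbors a).card : ℝ) = G.excess a + 1 := by
    have : (G.leafNeighbors a).card = G.excess a + 1 := by omega
    exact_mod_cast this
  have hy : (1 : ℝ) ≤ G.excess b := by
    have : 1 ≤ G.excess b := by omega
    exact_mod_cast this
  have hLy : ((G.leafNeighbors b).card : ℝ) ≤ G.excess b - 1 := by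
    have : (G.leafNeighbors b).card + 1 ≤ G.excess b := by omega
    have : ((G.leafNeighbors b).card : ℝ) + 1 ≤ G.excess b := by exact_mod_cast this
    linarith
  have hsplit := Finset.add_sum_erase Finset.univ (G.vertexShare lam) (Finset.mem_univ a)
  have hsplit' := Finset.add_sum_erase (Finset.univ.erase a) (G.vertexShare lam)
    (Finset.mem_erase.2 ⟨hab.symm, Finset.mem_univ b⟩)
  have hrest : 0 ≤ ∑ v ∈ (Finset.univ.erase a).erase b, G.vertexShare lam v :=
    Finset.sum_nonneg fun v _ => hshare v
  have hbshare : 2 * (2 + lam) + (G.excess b - 1) * ((1 + lam) * G.excess b + 2 * (2 + lam)) ≤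
      G.vertexShare lam b := by
    have := mul_le_mul_of_nonneg_right hLy (by linarith : (0 : ℝ) ≤ G.excess b)
    unfold SimpleGraph.vertexShare
    linarith
  have hpos : 0 < (1 + lam) * G.excess b + 2 * (2 + lam) := by
    have : 0 < (1 + lam) * (G.excess b : ℝ) := mul_pos (by linarith) (by linarith)
    linarith
  have hfirst : 0 ≤ ((G.excess b : ℝ) - 1) * ((1 + lam) * G.excess b + 2 * (2 + lam)) :=
    mul_nonneg (by linarith) hpos.le
  have hval : ((Δ : ℝ) + lam) * (Δ + Δ * lam + 1) + ((Fintype.card V : ℝ) - Δ) * (2 + lam) ^ 2 +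
      3 * (2 + lam) = Fintype.card V * (2 + lam) ^ 2 + G.vertexShare lam a + 2 * (2 + lam) := by
    rw [SimpleGraph.vertexShare, h1, hLk]
    ring
  have hGRM : GRM lam G = Fintype.card V * (2 + lam) ^ 2 + (G.vertexShare lam a +
      (G.vertexShare lam b + ∑ v ∈ (Finset.univ.erase a).erase b, G.vertexShare lam v)) +
      G.excessProduct := by
    rw [hU.GRM_eq, ← hsplit, ← hsplit']
  have hadjP : G.Adj a b → (G.excess a : ℝ) ≤ G.excessProduct := fun h =>
    le_trans (le_mul_of_one_le_right (by linarith) hy) (SimpleGraph.mul_excess_le_excessProduct h)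
  refine ⟨by linarith, fun heq => ?_, fun hn => ?_⟩
  · refine mem_starPathCycleGraphs_of_excess hΔ hG ha hL (b := b) ?_ ?_ ?_
    · intro h
      linarith [hadjP h]
    · have h2 : ((G.excess b : ℝ) - 1) * ((1 + lam) * G.excess b + 2 * (2 + lam)) = 0 := by linarith
      rcases mul_eq_zero.1 h2 with h | h
      · have : (G.excess b : ℝ) = 1 := by linarith
        have : G.excess b = 1 := by exact_mod_cast this
        omega
      · linarith
    · intro v hva hvb
      by_contra hne
      have h2 := SimpleGraph.vertexShare_pos hlam (hU.card_leafNeighbors_lt_degree v) hne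
      have h3 := Finset.single_le_sum (fun v _ => hshare v)
        (Finset.mem_erase.2 ⟨hvb, Finset.mem_erase.2 ⟨hva, Finset.mem_univ v⟩⟩)
      linarith
  · have hadj : G.Adj a b := by
      by_contra hnadj
      -- the only neighbour of `a` that could lie on the cycle is the second vertex of the path
      have hdisj : Disjoint (G.neighborFinset a) c.support.toFinset := by
        rw [Finset.disjoint_left]
        intro w hw hwc
        rw [List.mem_toFinset] at hwc
        rw [SimpleGraph.mem_neighborFinset] at hw
        have hsnd : q.snd ≠ w := by
          rintro rfl
          exact hnadj (hqc _ (q.getVert_mem_support 1) hwc ▸ hw)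
        have h2 := SimpleGraph.card_leafNeighbors_add_le (G := G) (v := a) (s := {q.snd, w}) (by
          intro y hy
          simp only [Finset.mem_insert, Finset.mem_singleton] at hy
          rcases hy with rfl | rfl
          · exact ⟨q.adj_snd fun h => hab h.eq, hq.degree_snd_ne_one hc hb hab⟩
          · have := hc.two_le_degree hwc
            exact ⟨hw, by omega⟩)
        rw [Finset.card_pair hsnd] at h2
        omega
      have ha' : a ∉ G.neighborFinset a ∪ c.support.toFinset := by
        simp [hac]
      have hcyc : 3 ≤ c.support.toFinset.card := by
        have h2 := List.toFinset_card_of_nodup hc.support_nodup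
        have h3 : c.support.tail.toFinset ⊆ c.support.toFinset := fun x hx => by
          rw [List.mem_toFinset] at hx ⊢
          exact List.mem_of_mem_tail hx
        have h4 := Finset.card_le_card h3
        have h5 := hc.three_le_length
        simp at h2
        omega
      have h2 := Finset.card_le_univ (insert a (G.neighborFinset a ∪ c.support.toFinset))
      rw [Finset.card_insert_of_notMem ha', Finset.card_union_of_disjoint hdisj,
        G.card_neighborFinset_eq_degree] at h2
      omega
    have h2 := hadjP hadj
    -- the two values differ by `2 * (2 + lam) - (Δ - 2)`, and the edge `ab` makes up for `Δ - 2`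
    nlinarith

end Bounds

/-! ### Constructing extremal graphs -/

section Construction

open scoped Classical

variable {V : Type*} {n : ℕ}

/-- The graph on `V`, with vertices numbered from `0` to `n - 1` by `f`, in which the vertex with
number `i` is joined to the one with number `P i` (if that is another vertex). -/
def parentGraph (f : V ≃ Fin n) (P : ℕ → ℕ) : SimpleGraph V :=
  SimpleGraph.fromRel fun x y => (f y : ℕ) = P (f x)

theorem parentGraph_adj {f : V ≃ Fin n} {P : ℕ → ℕ} {x y : V} :
    (parentGraph f P).Adj x y ↔ (f x : ℕ) ≠ f y ∧ ((f y : ℕ) = P (f x) ∨ (f x : ℕ) = P (f y)) := by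
  rw [parentGraph, SimpleGraph.fromRel_adj, ne_eq, ne_eq, Fin.val_inj, f.injective.eq_iff]

variable [Fintype V]

theorem degree_parentGraph (f : V ≃ Fin n) (P : ℕ → ℕ) (x : V) :
    (parentGraph f P).degree x = ((Finset.range n).filter fun j =>
      (f x : ℕ) ≠ j ∧ (j = P (f x) ∨ (f x : ℕ) = P j)).card := by
  rw [← SimpleGraph.card_neighborFinset_eq_degree]
  refine Finset.card_bij (fun y _ => (f y : ℕ)) ?_ ?_ ?_
  · intro y hy
    rw [SimpleGraph.mem_neighborFinset, parentGraph_adj] at hy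
    simpa using hy
  · intro y _ z _ h
    exact f.injective (Fin.val_injective h)
  · intro j hj
    rw [Finset.mem_filter, Finset.mem_range] at hj
    refine ⟨f.symm ⟨j, hj.1⟩, ?_, by simp⟩
    rw [SimpleGraph.mem_neighborFinset, parentGraph_adj]
    simpa using hj.2

/-- If `P` decreases all numbers but `0`, then the edges from `i` to `P i` with `0 < i` form a tree,
to which the edge from `0` to `P 0` is added. -/
theorem isUnicyclic_parentGraph (f : V ≃ Fin n) {P : ℕ → ℕ} (hn : 0 < n)
    (hP : ∀ i, 0 < i → P i < i) (h0 : 0 < P 0) (h0n : P 0 < n) (h00 : P (P 0) ≠ 0) :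
    IsUnicyclic (parentGraph f P) := by
  have hPn : ∀ x : V, P (f x) < n := by
    intro x
    rcases Nat.eq_zero_or_pos (f x : ℕ) with h | h
    · rwa [h]
    · exact (hP _ h).trans (f x).2
  have hPne : ∀ i, P i ≠ i := by
    intro i
    rcases Nat.eq_zero_or_pos i with rfl | h
    · exact h0.ne'
    · exact (hP _ h).ne
  have hadj : ∀ x : V, (parentGraph f P).Adj x (f.symm ⟨P (f x), hPn x⟩) := by
    intro x
    rw [parentGraph_adj]
    simpa using (hPne _).symm
  have hreach : ∀ i (hi : i < n),
      (parentGraph f P).Reachable (f.symm ⟨i, hi⟩) (f.symm ⟨0, hn⟩) := by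
    intro i
    induction i using Nat.strong_induction_on with
    | _ i ih =>
      intro hi
      rcases Nat.eq_zero_or_pos i with rfl | h
      · rfl
      · have h1 := hadj (f.symm ⟨i, hi⟩)
        simp only [Equiv.apply_symm_apply] at h1
        exact h1.reachable.trans (ih _ (hP i h) _)
  refine isUnicyclic_of_connected_of_card_edgeSet ?_ ?_
  · refine (SimpleGraph.connected_iff_exists_forall_reachable _).2 ⟨f.symm ⟨0, hn⟩, fun x => ?_⟩
    simpa using (hreach (f x) (f x).2).symm
  · have hedge : (parentGraph f P).edgeSet =
        Set.range fun x : V => s(x, f.symm ⟨P (f x), hPn x⟩) := by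
      ext e
      constructor
      · induction e with | h x y =>
        intro h
        rw [SimpleGraph.mem_edgeSet, parentGraph_adj] at h
        rcases h.2 with h | h
        · exact ⟨x, by simp [← h]⟩
        · refine ⟨y, ?_⟩
          simp only [← h, Fin.eta, Equiv.symm_apply_apply]
          exact Sym2.eq_swap
      · rintro ⟨x, rfl⟩
        exact hadj x
    rw [hedge, Nat.card_range_of_injective]
    intro x y hxy
    by_contra hne
    rcases Sym2.eq_iff.1 hxy with h | ⟨h1, h2⟩
    · exact hne h.1
    · have h3 : (f x : ℕ) = P (f y) := by
        conv_lhs => rw [h1]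
        simp
      have h4 : P (f x) = (f y : ℕ) := by
        rw [← h2]
        simp
      rcases Nat.eq_zero_or_pos (f x : ℕ) with hx | hx
      · rw [hx] at h3 h4
        rw [← h4] at h3
        exact h00 h3.symm
      · rcases Nat.eq_zero_or_pos (f y : ℕ) with hy | hy
        · rw [hy] at h3 h4
          rw [h3] at h4
          exact h00 h4
        · have := hP _ hx
          have := hP _ hy
          omega

theorem le_card_leafNeighbors_parentGraph (f : V ≃ Fin n) {P : ℕ → ℕ} {x : V} {m : ℕ}
    (h : ∀ y : V, m ≤ f y →
      (parentGraph f P).Adj x y ∧ (parentGraph f P).degree y = 1) :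
    n - m ≤ ((parentGraph f P).leafNeighbors x).card := by
  refine le_trans ?_ (Finset.card_image_le (f := fun y => (f y : ℕ)))
  rw [← Nat.card_Ico]
  refine Finset.card_le_card fun j hj => ?_
  rw [Finset.mem_Ico] at hj
  exact Finset.mem_image.2 ⟨f.symm ⟨j, hj.2⟩,
    SimpleGraph.mem_leafNeighbors.2 (h _ (by simpa using hj.1)), by simp⟩

theorem mem_unicyclicGraphs_of_degree {G : SimpleGraph V} {Δ : ℕ} {a : V} (hG : IsUnicyclic G)
    (ha : G.degree a = Δ) (hle : ∀ x, G.degree x ≤ Δ) : G ∈ unicyclicGraphs V Δ :=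
  ⟨hG, le_antisymm (G.maxDegree_le_of_forall_degree_le _ hle) (ha ▸ G.degree_le_maxDegree a)⟩

theorem starOnCycleGraphs_nonempty {Δ : ℕ} (hΔ : 3 ≤ Δ) (hn : Δ + 1 ≤ Fintype.card V) :
    (starOnCycleGraphs V Δ).Nonempty := by
  obtain ⟨n, hcard⟩ : ∃ n, Fintype.card V = n := ⟨_, rfl⟩
  rw [hcard] at hn
  let f : V ≃ Fin n := Fintype.equivFinOfCardEq hcard
  obtain ⟨m, hm⟩ : ∃ m, m + Δ = n + 2 := ⟨n + 2 - Δ, by omega⟩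
  -- a path on the numbers below `m`, closed up by the edge from `0` to `m - 1`; leaves at `0`
  obtain ⟨P, hP⟩ : ∃ P : ℕ → ℕ, ∀ i, P i = if i = 0 then m - 1 else if i < m then i - 1 else 0 :=
    ⟨_, fun _ => rfl⟩
  have hU : IsUnicyclic (parentGraph f P) := by
    refine isUnicyclic_parentGraph f (by omega) ?_ ?_ ?_ ?_ <;> simp only [hP] <;> grind
  let a : V := f.symm ⟨0, by omega⟩
  have hfa : (f a : ℕ) = 0 := by simp [a]
  have hda : (parentGraph f P).degree a = Δ := by
    have : ((Finset.range n).filter fun j => 0 ≠ j ∧ (j = P 0 ∨ 0 = P j)) =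
        insert 1 (Finset.Ico (m - 1) n) := by
      ext j
      simp only [Finset.mem_filter, Finset.mem_range, Finset.mem_insert, Finset.mem_Ico, hP]
      grind
    rw [degree_parentGraph, hfa, this, Finset.card_insert_of_notMem, Nat.card_Ico]
    · omega
    · rw [Finset.mem_Ico]
      omega
  have hd2 : ∀ x, x ≠ a → (parentGraph f P).degree x ≤ 2 := by
    intro x hx
    have hx0 : (f x : ℕ) ≠ 0 := fun h => hx (f.injective (Fin.val_injective (h.trans hfa.symm)))
    rw [degree_parentGraph]
    refine le_trans (Finset.card_le_card (t := {(f x : ℕ) - 1,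
      if (f x : ℕ) < m - 1 then (f x : ℕ) + 1 else 0}) ?_) Finset.card_le_two
    intro j hj
    simp only [Finset.mem_filter, Finset.mem_range, Finset.mem_insert, Finset.mem_singleton,
      hP] at hj ⊢
    grind
  have hd1 : ∀ x, m ≤ f x → (parentGraph f P).degree x = 1 := by
    intro x hx
    refine le_antisymm ?_ ?_
    · rw [degree_parentGraph]
      refine le_trans (Finset.card_le_card (t := {0}) ?_) (Finset.card_singleton 0).le
      intro j hj
      simp only [Finset.mem_filter, Finset.mem_range, Finset.mem_singleton, hP] at hj ⊢
      grind
    · have := hU.card_leafNeighbors_lt_degree x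
      omega
  refine ⟨_, mem_starOnCycleGraphs_of_excess hΔ (mem_unicyclicGraphs_of_degree hU hda fun x => ?_)
    hda ?_ fun x hx => ?_⟩
  · by_cases hx : x = a
    · rw [hx, hda]
    · have := hd2 x hx
      omega
  · have := le_card_leafNeighbors_parentGraph f (P := P) (x := a) (m := m) (fun y hy => by
      refine ⟨?_, hd1 y hy⟩
      rw [parentGraph_adj, hfa, hP (f y)]
      grind)
    omega
  · have := hd2 x hx
    unfold SimpleGraph.excess
    omega

theorem starPathCycleGraphs_nonempty {Δ : ℕ} (hΔ : 3 ≤ Δ) (hn : Δ + 3 < Fintype.card V) :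
    (starPathCycleGraphs V Δ).Nonempty := by
  obtain ⟨n, hcard⟩ : ∃ n, Fintype.card V = n := ⟨_, rfl⟩
  rw [hcard] at hn
  let f : V ≃ Fin n := Fintype.equivFinOfCardEq hcard
  obtain ⟨m, hm⟩ : ∃ m, m + Δ = n + 1 := ⟨n + 1 - Δ, by omega⟩
  -- a path on the numbers below `m`, with a triangle on `0`, `1`, `2`; leaves at `m - 1`
  obtain ⟨P, hP⟩ : ∃ P : ℕ → ℕ, ∀ i, P i = if i = 0 then 2 else if i < m then i - 1 else m - 1 :=
    ⟨_, fun _ => rfl⟩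
  have hU : IsUnicyclic (parentGraph f P) := by
    refine isUnicyclic_parentGraph f (by omega) ?_ ?_ ?_ ?_ <;> simp only [hP] <;> grind
  let a : V := f.symm ⟨m - 1, by omega⟩
  have hfa : (f a : ℕ) = m - 1 := by simp [a]
  let b : V := f.symm ⟨2, by omega⟩
  have hfb : (f b : ℕ) = 2 := by simp [b]
  have hda : (parentGraph f P).degree a = Δ := by
    have : ((Finset.range n).filter fun j => m - 1 ≠ j ∧ (j = P (m - 1) ∨ m - 1 = P j)) =
        insert (m - 2) (Finset.Ico m n) := by
      ext j
      simp only [Finset.mem_filter, Finset.mem_range, Finset.mem_insert, Finset.mem_Ico, hP]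
      grind
    rw [degree_parentGraph, hfa, this, Finset.card_insert_of_notMem, Nat.card_Ico]
    · omega
    · rw [Finset.mem_Ico]
      omega
  have hdb : (parentGraph f P).degree b ≤ 3 := by
    rw [degree_parentGraph, hfb]
    refine le_trans (Finset.card_le_card (t := {0, 1, 3}) ?_) Finset.card_le_three
    intro j hj
    simp only [Finset.mem_filter, Finset.mem_range, Finset.mem_insert, Finset.mem_singleton,
      hP] at hj ⊢
    grind
  have hd2 : ∀ x, x ≠ a → x ≠ b → (parentGraph f P).degree x ≤ 2 := by
    intro x hxa hxb
    have hxa' : (f x : ℕ) ≠ m - 1 :=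
      fun h => hxa (f.injective (Fin.val_injective (h.trans hfa.symm)))
    have hxb' : (f x : ℕ) ≠ 2 :=
      fun h => hxb (f.injective (Fin.val_injective (h.trans hfb.symm)))
    rw [degree_parentGraph]
    refine le_trans (Finset.card_le_card (t := {if (f x : ℕ) = 0 then 2 else
      if (f x : ℕ) < m then (f x : ℕ) - 1 else m - 1, (f x : ℕ) + 1}) ?_) Finset.card_le_two
    intro j hj
    simp only [Finset.mem_filter, Finset.mem_range, Finset.mem_insert, Finset.mem_singleton,
      hP] at hj ⊢
    grind
  have hd1 : ∀ x, m ≤ f x → (parentGraph f P).degree x = 1 := by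
    intro x hx
    refine le_antisymm ?_ ?_
    · rw [degree_parentGraph]
      refine le_trans (Finset.card_le_card (t := {m - 1}) ?_) (Finset.card_singleton _).le
      intro j hj
      simp only [Finset.mem_filter, Finset.mem_range, Finset.mem_singleton, hP] at hj ⊢
      grind
    · have := hU.card_leafNeighbors_lt_degree x
      omega
  refine ⟨_, mem_starPathCycleGraphs_of_excess hΔ (mem_unicyclicGraphs_of_degree hU hda fun x => ?_)
    hda ?_ (b := b) ?_ hdb fun x hxa hxb => ?_⟩
  · by_cases hxa : x = a
    · rw [hxa, hda]
    by_cases hxb : x = b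
    · rw [hxb]
      omega
    · have := hd2 x hxa hxb
      omega
  · have := le_card_leafNeighbors_parentGraph f (P := P) (x := a) (m := m) (fun y hy => by
      refine ⟨?_, hd1 y hy⟩
      rw [parentGraph_adj, hfa, hP (f y)]
      grind)
    omega
  · rw [parentGraph_adj, hfa, hfb, hP, hP]
    grind
  · have := hd2 x hxa hxb
    unfold SimpleGraph.excess
    omega

end Construction

/-! ### Comparing the two extremal values -/

open Classical in
/-- The two cases are that at least two neighbours of a vertex of maximum degree are not leaves, and
that only one is not. -/
theorem GRM_lower_bound_or {V : Type*} [Fintype V] {G : SimpleGraph V} {Δ : ℕ} {lam : ℝ}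
    (hlam : -1 / 2 ≤ lam) (hΔ : 3 ≤ Δ) (hG : G ∈ unicyclicGraphs V Δ) :
    (((Δ : ℝ) + lam) * (Δ + Δ * lam + 2) +
        ((Fintype.card V : ℝ) - Δ) * (2 + lam) ^ 2 ≤ GRM lam G ∧
      (GRM lam G = ((Δ : ℝ) + lam) * (Δ + Δ * lam + 2) +
        ((Fintype.card V : ℝ) - Δ) * (2 + lam) ^ 2 → G ∈ starOnCycleGraphs V Δ)) ∨
    ((((Δ : ℝ) + lam) * (Δ + Δ * lam + 1) + ((Fintype.card V : ℝ) - Δ) * (2 + lam) ^ 2 +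
        3 * (2 + lam) ≤ GRM lam G) ∧
      (GRM lam G = ((Δ : ℝ) + lam) * (Δ + Δ * lam + 1) +
        ((Fintype.card V : ℝ) - Δ) * (2 + lam) ^ 2 + 3 * (2 + lam) →
          G ∈ starPathCycleGraphs V Δ) ∧
      (Fintype.card V ≤ Δ + 3 → ((Δ : ℝ) + lam) * (Δ + Δ * lam + 2) +
        ((Fintype.card V : ℝ) - Δ) * (2 + lam) ^ 2 < GRM lam G)) := by
  have := hG.1.1.nonempty
  obtain ⟨a, ha⟩ := G.exists_maximal_degree_vertex
  replace ha : G.degree a = Δ := by rw [← ha, hG.2]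
  rcases Nat.lt_or_ge ((G.leafNeighbors a).card + 1) Δ with hL | hL
  · exact .inl (starOnCycle_le_GRM_of_card_leafNeighbors_le hlam hΔ hG ha (by omega))
  · exact .inr (starPathCycle_le_GRM_of_le_card_leafNeighbors hlam hΔ hG ha hL)

theorem theorem2 {V : Type*} [Fintype V] (n Δ : ℕ) (hn : Fintype.card V = n)
    (lam : ℝ) (hlam : -1 / 2 ≤ lam) (hΔ : 3 ≤ Δ) :
    -- the extremal families are not empty
    (Δ + 3 < n → (starPathCycleGraphs V Δ).Nonempty) ∧
    (Δ + 1 ≤ n → (starOnCycleGraphs V Δ).Nonempty) ∧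
    ∀ U ∈ unicyclicGraphs V Δ,
      -- (i)
      (2 * lam + 6 < (Δ : ℝ) → Δ + 3 < n →
        ((Δ : ℝ) + lam) * (Δ + Δ * lam + 1) + ((n : ℝ) - Δ) * (2 + lam) ^ 2 + 3 * (2 + lam)
            ≤ GRM lam U ∧
        (GRM lam U =
            ((Δ : ℝ) + lam) * (Δ + Δ * lam + 1) + ((n : ℝ) - Δ) * (2 + lam) ^ 2 + 3 * (2 + lam) ↔
          U ∈ starPathCycleGraphs V Δ)) ∧
      -- (ii)
      ((Δ : ℝ) < 2 * lam + 6 ∨ n ≤ Δ + 3 →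
        ((Δ : ℝ) + lam) * (Δ + Δ * lam + 2) + ((n : ℝ) - Δ) * (2 + lam) ^ 2 ≤ GRM lam U ∧
        (GRM lam U = ((Δ : ℝ) + lam) * (Δ + Δ * lam + 2) + ((n : ℝ) - Δ) * (2 + lam) ^ 2 ↔
          U ∈ starOnCycleGraphs V Δ)) ∧
      -- (iii)
      ((Δ : ℝ) = 2 * lam + 6 →
        6 * (2 + lam) ^ 3 + ((n : ℝ) - 2 * lam - 6) * (2 + lam) ^ 2 ≤ GRM lam U ∧
        (GRM lam U = 6 * (2 + lam) ^ 3 + ((n : ℝ) - 2 * lam - 6) * (2 + lam) ^ 2 ↔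
          U ∈ starPathCycleGraphs V Δ ∨ U ∈ starOnCycleGraphs V Δ)) := by
  subst hn
  refine ⟨starPathCycleGraphs_nonempty hΔ, starOnCycleGraphs_nonempty hΔ, fun U hU => ?_⟩
  have hval₂ := GRM_eq_of_mem_starPathCycleGraphs (G := U) (lam := lam) hΔ
  have hval₃ := GRM_eq_of_mem_starOnCycleGraphs (G := U) (lam := lam) hΔ
  have hdiff : ((Δ : ℝ) + lam) * (Δ + Δ * lam + 2) =
      ((Δ : ℝ) + lam) * (Δ + Δ * lam + 1) + 3 * (2 + lam) + (Δ - (2 * lam + 6)) := by ring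
  have hbound := GRM_lower_bound_or hlam hΔ hU
  refine ⟨fun h _ => ⟨?_, fun heq => ?_, hval₂⟩, fun h => ⟨?_, fun heq => ?_, hval₃⟩,
    fun h => ?_⟩
  · rcases hbound with ⟨h1, -⟩ | ⟨h1, -, -⟩ <;> linarith
  · rcases hbound with ⟨h1, -⟩ | ⟨-, h2, -⟩
    · linarith
    · exact h2 heq
  · rcases hbound with ⟨h1, -⟩ | ⟨h1, -, h3⟩
    · exact h1
    · rcases h with h | h
      · linarith
      · exact (h3 h).le
  · rcases hbound with ⟨-, h2⟩ | ⟨h1, -, h3⟩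
    · exact h2 heq
    · rcases h with h | h
      · linarith
      · exact absurd heq (h3 h).ne'
  · have hval : 6 * (2 + lam) ^ 3 + ((Fintype.card V : ℝ) - 2 * lam - 6) * (2 + lam) ^ 2 =
        ((Δ : ℝ) + lam) * (Δ + Δ * lam + 2) +
          ((Fintype.card V : ℝ) - Δ) * (2 + lam) ^ 2 := by
      rw [h]
      ring
    rw [hval]
    refine ⟨?_, fun heq => ?_, ?_⟩
    · rcases hbound with ⟨h1, -⟩ | ⟨h1, -, -⟩ <;> linarith
    · rcases hbound with ⟨-, h2⟩ | ⟨-, h2, -⟩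
      · exact .inr (h2 heq)
      · exact .inl (h2 (by linarith))
    · rintro (hmem | hmem)
      · linarith [hval₂ hmem]
      · exact hval₃ hmem
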